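/- Let $K$ be an arbitrary field and let $\Lambda=\Lambda(x_i\mid i\ge 0)$ be the Grassmann algebra over $K$ in countably many odd variables, with superderivatives $\partial_i$ determined by $\partial_i(x_j)=\delta_{i,j}$; identify $x_i$ with left multiplication by $x_i$. The associative superalgebra $\mathrm{End}\,\Lambda$ is regarded as a Lie superalgebra under the supercommutator $[a,b]=ab-(-1)^{|a||b|}ba$. Define the (odd) pivot elements $$v_i=\partial_i+x_ix_{i+1}\bigl(\partial_{i+3}+x_{i+3}x_{i+4}(\partial_{i+6}+\cdots)\bigr)\in\mathrm{End}\,\Lambda,\qquad i\ge 0,$$ and let $\mathbf Q=\mathrm{Lie}(v_0,v_1,v_2)\subset\mathrm{End}\,\Lambda$ be the Lie superalgebra generated by $v_0,v_1,v_2$ (if $\mathrm{char}\,K=2$, a Lie superalgebra is also required to be closed under the formal square $a\mapsto a^2$ of odd elements). For $n_1,n_2,n_3\ge 0$ let $\mathbf Q_{n_1,n_2,n_3}$ be the span of all Lie products (if $\mathrm{char}\,K=2$, including formal squares of odd products) in which $v_0,v_1,v_2$ enter $n_1,n_2,n_3$ times, respectively. Theorem. The Lie superalgebra $\mathbf Q$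 is $\mathbb N_0^3$-graded by multidegree in the generators: $$\mathbf Q=\bigoplus_{n_1,n_2,n_3\ge 0}\mathbf Q_{n_1,n_2,n_3},\qquad [\mathbf Q_{n},\mathbf Q_{m}]\subset\mathbf Q_{n+m}$$ (the components are $\mathbb Z_2$-graded subspaces and, if $\mathrm{char}\,K=2$, the formal square maps odd elements of $\mathbf Q_n$ into $\mathbf Q_{2n}$). Moreover $\dim_K\mathbf Q_{n_1,n_2,n_3}\le 1$ for all $n_1,n_2,n_3\ge 0$. Consequently this grading is fine, i.e. it has no proper refinement: if $\mathbf Q=\bigoplus_{s}D_s$ is any grading (a direct sum decomposition into nonzero subspaces such that for all $s,t$ there is $r$ with $[D_s,D_t]\subset D_r$) and every $D_s$ lies in some $\mathbf Q_{n_1,n_2,n_3}$, then the $D_s$ are exactly the nonzero components $\mathbf Q_{n_1,n_2,n_3}$. -/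

import Mathlib

namespace PivotLie

section Grassmann

variable (K : Type*) [Field K]

/-- The Grassmann algebra `Λ = Λ(x_i | i ≥ 0)` in countably many variables. -/
noncomputable abbrev Grassmann := ExteriorAlgebra K (ℕ →₀ K)

/-- The parity grading `Λ = Λ_0 ⊕ Λ_1`. -/
noncomputable abbrev grassmannParity : ZMod 2 → Submodule K (Grassmann K) :=
  CliffordAlgebra.evenOdd (0 : QuadraticForm K (ℕ →₀ K))

/-- The Grassmann letter `x_i`. -/
noncomputable def x (i : ℕ) : Grassmann K :=
  ExteriorAlgebra.ι K (Finsupp.single i 1)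

/-- The superderivative `∂_i` with `∂_i (x_j) = δ_{ij}`, that is, the left contraction by the
`i`-th coordinate functional: `∂_i 1 = 0` and `∂_i (x_j f) = δ_{ij} f - x_j ∂_i f`. -/
noncomputable def partialDeriv (i : ℕ) : Module.End K (Grassmann K) :=
  CliffordAlgebra.contractLeft (Q := (0 : QuadraticForm K (ℕ →₀ K))) (Finsupp.lapply i)

/-- `x_i x_{i+1} · x_{i+3} x_{i+4} ⋯ x_{i+3(l-1)} x_{i+3(l-1)+1}` (the empty product if `l = 0`),
the coefficient of `∂_{i+3l}` in the expansion of the pivot element `v_i`. -/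
noncomputable def pivotCoeff : ℕ → ℕ → Grassmann K
  | _, 0 => 1
  | i, l + 1 => x K i * x K (i + 1) * pivotCoeff (i + 3) l

variable {K}

theorem finite_partialDeriv_ne_zero (f : Grassmann K) :
    {i : ℕ | partialDeriv K i f ≠ 0}.Finite := by
  induction f using CliffordAlgebra.left_induction with
  | algebraMap r =>
    have h : {i : ℕ | partialDeriv K i (algebraMap K _ r) ≠ 0} = ∅ := by
      ext i
      simp [partialDeriv, CliffordAlgebra.contractLeft_algebraMap]
    exact h ▸ Set.finite_empty
  | add a b ha hb =>
    refine (ha.union hb).subset fun i hi => ?_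
    by_contra h
    simp only [Set.mem_union, Set.mem_ofPred_eq, not_or, not_not] at h
    exact hi (by rw [map_add, h.1, h.2, add_zero])
  | ι_mul b m hb =>
    refine (hb.union m.support.finite_toSet).subset fun i hi => ?_
    by_contra h
    simp only [Set.mem_union, Set.mem_ofPred_eq, not_or, not_not, Finset.mem_coe,
      Finsupp.notMem_support_iff] at h
    refine hi ?_
    have h1 := h.1
    simp only [partialDeriv] at h1 ⊢
    rw [CliffordAlgebra.contractLeft_ι_mul, h1]
    simp [h.2]

theorem finite_support_pivotTerm (i : ℕ) (f : Grassmann K) :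
    (Function.support fun l : ℕ => pivotCoeff K i l * partialDeriv K (i + 3 * l) f).Finite := by
  refine ((finite_partialDeriv_ne_zero f).preimage
    (f := fun l : ℕ => i + 3 * l) ?_).subset fun l hl h => hl ?_
  · intro a _ b _ h
    simp only at h
    omega
  · simp [h]

variable (K)

/-- The pivot element
`v_i = ∂_i + x_i x_{i+1} (∂_{i+3} + x_{i+3} x_{i+4} (∂_{i+6} + ⋯))`, as an operator on `Λ`;
on every `f ∈ Λ` only finitely many terms are nonzero. -/
noncomputable def pivot (i : ℕ) : Module.End K (Grassmann K) where
  toFun f := ∑ᶠ l : ℕ, pivotCoeff K i l * partialDeriv K (i + 3 * l) f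
  map_add' f g := by
    simp only [map_add, mul_add]
    exact finsum_add_distrib (finite_support_pivotTerm i f) (finite_support_pivotTerm i g)
  map_smul' c f := by
    simp only [map_smul, mul_smul_comm, RingHom.id_apply]
    exact (smul_finsum' c (finite_support_pivotTerm i f)).symm

/-- The component `End_a Λ` of the associative superalgebra `End Λ`: the operators mapping
`Λ_b` to `Λ_{a+b}` for all `b`. -/
noncomputable def endParity (a : ZMod 2) : Submodule K (Module.End K (Grassmann K)) where
  carrier := {φ | ∀ b, ∀ f ∈ grassmannParity K b, φ f ∈ grassmannParity K (a + b)}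
  zero_mem' := fun _ _ _ => Submodule.zero_mem _
  add_mem' := fun hφ hψ b f hf => Submodule.add_mem _ (hφ b f hf) (hψ b f hf)
  smul_mem' := fun c _ hφ b f hf => Submodule.smul_mem _ c (hφ b f hf)

variable {K}

/-- The component in `End_a Λ` of an operator on `Λ`. -/
noncomputable def parityPart (a : ZMod 2) (φ : Module.End K (Grassmann K)) :
    Module.End K (Grassmann K) :=
  ∑ b : ZMod 2, GradedAlgebra.proj (grassmannParity K) (a + b) ∘ₗ φ ∘ₗ
    GradedAlgebra.proj (grassmannParity K) b

/-- The supercommutator on `End Λ`, the bilinear operation with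
`[φ, ψ] = φ ψ - (-1)^{|φ||ψ|} ψ φ` for homogeneous `φ`, `ψ`. -/
noncomputable def superBracket (φ ψ : Module.End K (Grassmann K)) :
    Module.End K (Grassmann K) :=
  ∑ a : ZMod 2, ∑ b : ZMod 2, (parityPart a φ * parityPart b ψ -
    (-1 : K) ^ (a.val * b.val) • (parityPart b ψ * parityPart a φ))

/-- Lie subsuperalgebras of `End Λ`: graded subspaces closed under the supercommutator and, in
characteristic `2`, under the formal square `φ ↦ φ²` of odd elements. -/
structure IsLieSubsuperalgebra (S : Submodule K (Module.End K (Grassmann K))) : Prop where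
  parityPart_mem : ∀ a, ∀ φ ∈ S, parityPart a φ ∈ S
  bracket_mem : ∀ φ ∈ S, ∀ ψ ∈ S, superBracket φ ψ ∈ S
  sq_mem : CharP K 2 → ∀ φ ∈ S, φ ∈ endParity K 1 → φ * φ ∈ S

variable (K)

/-- The Lie superalgebra `Q = Lie(v_0, v_1, v_2)`: the smallest Lie subsuperalgebra of `End Λ`
that contains `v_0`, `v_1`, `v_2`. -/
noncomputable def Q : Submodule K (Module.End K (Grassmann K)) :=
  sInf {S | IsLieSubsuperalgebra S ∧ ∀ i : Fin 3, pivot K i ∈ S}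

/-- `IsLieMonomial K n φ`: the operator `φ` is a Lie product of `v_0, v_1, v_2` (in characteristic
`2`, formal squares of odd products are also used) in which each `v_i` enters `n i` times. -/
inductive IsLieMonomial : (Fin 3 → ℕ) → Module.End K (Grassmann K) → Prop
  | gen (i : Fin 3) : IsLieMonomial (Pi.single i 1) (pivot K i)
  | bracket {m n : Fin 3 → ℕ} {φ ψ : Module.End K (Grassmann K)} :
      IsLieMonomial m φ → IsLieMonomial n ψ → IsLieMonomial (m + n) (superBracket φ ψ)
  | sq {n : Fin 3 → ℕ} {φ : Module.End K (Grassmann K)} :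
      CharP K 2 → IsLieMonomial n φ → φ ∈ endParity K 1 → IsLieMonomial (n + n) (φ * φ)

/-- The component `Q_{n_1,n_2,n_3}`: the span of all Lie products of multidegree
`(n_1,n_2,n_3)` in `v_0, v_1, v_2`. -/
noncomputable def QComponent (n : Fin 3 → ℕ) : Submodule K (Module.End K (Grassmann K)) :=
  Submodule.span K {φ | IsLieMonomial K n φ}

variable {K}

/-- `L = ⨁ 𝒜 i` is a grading of the Lie superalgebra `L ⊆ End Λ` by the additive monoid `ι`
(in characteristic `2`, the formal square is required to double degrees). -/
structure IsGrading {ι : Type*} [AddMonoid ι] (L : Submodule K (Module.End K (Grassmann K)))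
    (𝒜 : ι → Submodule K (Module.End K (Grassmann K))) : Prop where
  iSup_eq : ⨆ i, 𝒜 i = L
  indep : iSupIndep 𝒜
  parityPart_mem : ∀ i a, ∀ φ ∈ 𝒜 i, parityPart a φ ∈ 𝒜 i
  bracket_mem : ∀ i j, ∀ φ ∈ 𝒜 i, ∀ ψ ∈ 𝒜 j, superBracket φ ψ ∈ 𝒜 (i + j)
  sq_mem : CharP K 2 → ∀ i, ∀ φ ∈ 𝒜 i, φ ∈ endParity K 1 → φ * φ ∈ 𝒜 (i + i)

/-- The set `𝒟` of subspaces is the set of nonzero components of a grading of `L`, in the widest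
sense: `L` is the direct sum of the subspaces in `𝒟`, and the product of any two of them lies in
a third. The nonzero components of a grading by any group or semigroup form such a set. -/
structure IsSetGrading (L : Submodule K (Module.End K (Grassmann K)))
    (𝒟 : Set (Submodule K (Module.End K (Grassmann K)))) : Prop where
  ne_bot : ∀ D ∈ 𝒟, D ≠ ⊥
  sSup_eq : sSup 𝒟 = L
  indep : sSupIndep 𝒟
  bracket_mem : ∀ D ∈ 𝒟, ∀ E ∈ 𝒟, ∃ F ∈ 𝒟, ∀ φ ∈ D, ∀ ψ ∈ E, superBracket φ ψ ∈ F

/-- A grading is fine if it has no proper refinement: whenever every component of another grading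
of `L` lies in a component of the given one, the nonzero components of the two coincide. -/
def IsFineGrading {ι : Type*} [AddMonoid ι] (L : Submodule K (Module.End K (Grassmann K)))
    (𝒜 : ι → Submodule K (Module.End K (Grassmann K))) : Prop :=
  IsGrading L 𝒜 ∧ ∀ 𝒟 : Set (Submodule K (Module.End K (Grassmann K))), IsSetGrading L 𝒟 →
    (∀ D ∈ 𝒟, ∃ i, D ≤ 𝒜 i) → 𝒟 = {D | D ≠ ⊥ ∧ ∃ i, D = 𝒜 i}

end Grassmann

end PivotLie

/-!
The proof exhibits monomials `x_S v_n`, where `x_S` is a product of distinct letters, such that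
every Lie product of `v_0, v_1, v_2` is a scalar multiple of one of them, and such that the
multidegree determines the monomial.

The recursion `v_n = ∂_n + x_n x_{n+1} v_{n+3}` gives `v_n² = x_{n+1} v_{n+3}`,
`{v_n, v_{n+1}} = - x_n v_{n+3}` and `{v_n, v_m} = x_n x_{n+1} {v_{n+3}, v_m}` for `m ≥ n + 2`
(`pivot_pivot_self`, `pivotAnticomm_succ`, `pivotAnticomm_of_add_two_le`). For `n ≤ m` the
supercommutator of `x_S v_n` and `x_T v_m` is `x_S v_n(x_T) v_m ± x_S x_T {v_n, v_m}`, where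
each term is a multiple of a monomial and at most one term is nonzero
(`pivot_eq_zero_or_mul_pivotAnticomm_eq_zero`). A monomial `x_S v_n` is called standard if the
letters of `S` precede `x_{n-1}` and `S` does not contain both `n - 3` and `n - 2`. Multiples of
standard monomials are closed under supercommutators and formal squares, which proves
`IsLieMonomial.isStandardMultiple`. All of this holds in every characteristic.

Give `v_n` the weight `λⁿ` and `x_i` the weight `- λⁱ` in `ℤ[λ]/(λ³ - λ - 2) ≅ ℤ³`; this is
compatible with the recursion because `λ^{n+3} = 2 λⁿ + λ^{n+1}`, and it extends the
multidegree. Since `λ` has norm `2`, the set `S` is read off from the weight `λⁿ - ∑_{i ∈ S} λⁱ` of `x_S v_n` as digits in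
base `λ`, modulo the relation between `v_n` and `x_n x_{n+1} v_{n+3}`, which have equal weights;
standardness keeps only one of them (`IsStandard.eq_of_weight_eq`). Hence a component has
dimension at most one. The operators `x_S v_n` are linearly independent, as is seen on the letter
`x_n`, so the sum of the components is direct. A grading with components of dimension at most one
has no proper refinement.
-/

namespace PivotLie

/-! ### Monomials of the Grassmann algebra -/

section

variable (K : Type*) [Field K]

/-- The monomial `x_S`, the product of the letters `x_i` with `i ∈ S` in increasing order. -/
noncomputable def xMonomial (S : Finset ℕ) : Grassmann K :=
  (Finsupp.basisSingleOne : Module.Basis ℕ K (ℕ →₀ K)).ExteriorAlgebra S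

/-- The line spanned by the monomial `x_S`. Working with lines rather than monomials avoids
computing the signs that arise when the letters of a product are sorted. -/
noncomputable def monomialLine (S : Finset ℕ) : Submodule K (Grassmann K) :=
  K ∙ xMonomial K S

theorem xMonomial_mem (S : Finset ℕ) : xMonomial K S ∈ monomialLine K S :=
  Submodule.mem_span_singleton_self _

variable {K}

theorem xMonomial_mul_of_disjoint {S T : Finset ℕ} (h : Disjoint S T) :
    ∃ ε : ℤˣ, xMonomial K S * xMonomial K T = ε • xMonomial K (S ∪ T) := by
  rw [← Finset.disjUnion_eq_union S T h]
  exact ⟨_, ExteriorAlgebra.basis_mul_of_disjoint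
    (Finsupp.basisSingleOne : Module.Basis ℕ K (ℕ →₀ K)) ⟨S, rfl⟩ ⟨T, rfl⟩ h⟩

theorem xMonomial_mul_of_not_disjoint {S T : Finset ℕ} (h : ¬ Disjoint S T) :
    xMonomial K S * xMonomial K T = 0 :=
  ExteriorAlgebra.basis_mul_of_not_disjoint (Finsupp.basisSingleOne : Module.Basis ℕ K (ℕ →₀ K))
    ⟨S, rfl⟩ ⟨T, rfl⟩ h

theorem xMonomial_empty : xMonomial K ∅ = 1 := by
  rw [xMonomial, ExteriorAlgebra.basis_apply_ofCard (n := 0) _ rfl]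
  simp [ExteriorAlgebra.ιMulti_family]

theorem xMonomial_singleton (i : ℕ) : xMonomial K {i} = x K i := by
  rw [xMonomial, ExteriorAlgebra.basis_apply_ofCard (n := 1) _ (Finset.card_singleton i)]
  have h : ∀ j : Fin 1,
      (Set.powersetCard.ofFinEmbEquiv.symm
        (Set.powersetCard.ofCard (Finset.card_singleton i))) j = i := by
    intro j
    have := (Set.powersetCard.mem_range_ofFinEmbEquiv_symm_iff_mem
      (s := Set.powersetCard.ofCard (Finset.card_singleton i))
      (i := (Set.powersetCard.ofFinEmbEquiv.symm
        (Set.powersetCard.ofCard (Finset.card_singleton i))) j)).1 ⟨j, rfl⟩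
    exact Finset.mem_singleton.1 this
  simp [ExteriorAlgebra.ιMulti_family, h, ExteriorAlgebra.ιMulti_apply, x]

theorem units_smul_mem_monomialLine {S : Finset ℕ} {f : Grassmann K} (ε : ℤˣ)
    (hf : f ∈ monomialLine K S) : ε • f ∈ monomialLine K S := by
  rcases Int.units_eq_one_or ε with rfl | rfl
  · simpa using hf
  · simpa [Units.smul_def] using hf

theorem mul_mem_monomialLine {S T : Finset ℕ} (h : Disjoint S T) {f g : Grassmann K}
    (hf : f ∈ monomialLine K S) (hg : g ∈ monomialLine K T) :
    f * g ∈ monomialLine K (S ∪ T) := by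
  obtain ⟨a, rfl⟩ := Submodule.mem_span_singleton.1 hf
  obtain ⟨b, rfl⟩ := Submodule.mem_span_singleton.1 hg
  obtain ⟨ε, hε⟩ := xMonomial_mul_of_disjoint (K := K) h
  rw [smul_mul_smul_comm, hε]
  exact Submodule.smul_mem _ _ (units_smul_mem_monomialLine ε (xMonomial_mem K _))

theorem mul_eq_zero_of_not_disjoint {S T : Finset ℕ} (h : ¬ Disjoint S T) {f g : Grassmann K}
    (hf : f ∈ monomialLine K S) (hg : g ∈ monomialLine K T) : f * g = 0 := by
  obtain ⟨a, rfl⟩ := Submodule.mem_span_singleton.1 hf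
  obtain ⟨b, rfl⟩ := Submodule.mem_span_singleton.1 hg
  rw [smul_mul_smul_comm, xMonomial_mul_of_not_disjoint h, smul_zero]

theorem x_mem_monomialLine (i : ℕ) : x K i ∈ monomialLine K {i} := by
  rw [← xMonomial_singleton]
  exact xMonomial_mem K _

theorem one_mem_monomialLine : (1 : Grassmann K) ∈ monomialLine K ∅ := by
  rw [← xMonomial_empty]
  exact xMonomial_mem K _

theorem x_mul_mem_monomialLine {S : Finset ℕ} {i : ℕ} (h : i ∉ S) {f : Grassmann K}
    (hf : f ∈ monomialLine K S) : x K i * f ∈ monomialLine K (insert i S) := by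
  rw [Finset.insert_eq]
  exact mul_mem_monomialLine (by simpa using h) (x_mem_monomialLine i) hf

theorem x_mul_eq_zero {S : Finset ℕ} {i : ℕ} (h : i ∈ S) {f : Grassmann K}
    (hf : f ∈ monomialLine K S) : x K i * f = 0 :=
  mul_eq_zero_of_not_disjoint (by simpa using h) (x_mem_monomialLine i) hf

theorem mul_x_eq_zero {S : Finset ℕ} {i : ℕ} (h : i ∈ S) {f : Grassmann K}
    (hf : f ∈ monomialLine K S) : f * x K i = 0 :=
  mul_eq_zero_of_not_disjoint (by simpa using h) hf (x_mem_monomialLine i)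

/-- Any letter of a monomial can be moved to the front. -/
theorem exists_eq_x_mul {S : Finset ℕ} {i : ℕ} (h : i ∈ S) {f : Grassmann K}
    (hf : f ∈ monomialLine K S) : ∃ g ∈ monomialLine K (S.erase i), f = x K i * g := by
  obtain ⟨a, rfl⟩ := Submodule.mem_span_singleton.1 hf
  obtain ⟨ε, hε⟩ := xMonomial_mul_of_disjoint (K := K) (S := {i}) (T := S.erase i) (by simp)
  rw [← Finset.insert_eq, Finset.insert_erase h, xMonomial_singleton] at hε
  refine ⟨a • ε⁻¹ • xMonomial K (S.erase i),
    Submodule.smul_mem _ _ (units_smul_mem_monomialLine _ (xMonomial_mem K _)), ?_⟩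
  rw [mul_smul_comm, mul_smul_comm, hε, inv_smul_smul]

theorem monomialLine_induction {motive : Finset ℕ → Grassmann K → Prop}
    (scalar : ∀ a : K, motive ∅ (algebraMap K _ a))
    (x_mul : ∀ (S : Finset ℕ) (i : ℕ) (f : Grassmann K), i ∉ S → f ∈ monomialLine K S →
      motive S f → motive (insert i S) (x K i * f))
    {S : Finset ℕ} {f : Grassmann K} (hf : f ∈ monomialLine K S) : motive S f := by
  induction S using Finset.induction generalizing f with
  | empty =>
    obtain ⟨a, rfl⟩ := Submodule.mem_span_singleton.1 hf
    simpa [xMonomial_empty, Algebra.algebraMap_eq_smul_one] using scalar a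
  | insert i S hi ih =>
    obtain ⟨g, hg, rfl⟩ := exists_eq_x_mul (Finset.mem_insert_self i S) hf
    rw [Finset.erase_insert hi] at hg
    exact x_mul S i g hi hg (ih hg)

theorem x_mul_self (i : ℕ) : x K i * x K i = 0 := ExteriorAlgebra.ι_sq_zero _

theorem x_mul_x_mul_self (i : ℕ) (f : Grassmann K) : x K i * (x K i * f) = 0 := by
  rw [← mul_assoc, x_mul_self, zero_mul]

theorem x_mul_x_comm (i j : ℕ) : x K i * x K j = - (x K j * x K i) :=
  eq_neg_of_add_eq_zero_left (ExteriorAlgebra.ι_add_mul_swap _ _)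

/-- Supercommutativity of the Grassmann algebra, for a letter and a monomial. -/
theorem x_mul_comm {S : Finset ℕ} {f : Grassmann K} (hf : f ∈ monomialLine K S) (i : ℕ) :
    f * x K i = (-1) ^ S.card * (x K i * f) := by
  refine monomialLine_induction (motive := fun S f => f * x K i = (-1) ^ S.card * (x K i * f))
    (fun a => ?_) (fun S j f hj hf ih => ?_) hf
  · simp [Algebra.commutes]
  · rw [mul_assoc, ih, Finset.card_insert_of_notMem hj, pow_succ, mul_assoc, neg_one_mul,
      ← mul_assoc (x K i), x_mul_x_comm i j, neg_mul, neg_neg, mul_assoc (x K j)]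
    rcases neg_one_pow_eq_or (Grassmann K) S.card with h | h <;> simp [h]

/-- Supercommutativity of the Grassmann algebra, for monomials. -/
theorem monomial_mul_comm {S T : Finset ℕ} {f g : Grassmann K} (hf : f ∈ monomialLine K S)
    (hg : g ∈ monomialLine K T) : g * f = (-1) ^ (S.card * T.card) * (f * g) := by
  refine monomialLine_induction (motive := fun S f => g * f = (-1) ^ (S.card * T.card) * (f * g))
    (fun a => ?_) (fun S j f hj hf ih => ?_) hf
  · simp [Algebra.commutes]
  · rw [← mul_assoc, x_mul_comm hg, mul_assoc, mul_assoc (x K j), ih,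
      Finset.card_insert_of_notMem hj, add_one_mul, pow_add, mul_assoc (x K j)]
    rcases neg_one_pow_eq_or (Grassmann K) T.card with h | h <;>
    rcases neg_one_pow_eq_or (Grassmann K) (S.card * T.card) with h' | h' <;> simp [h, h']

theorem x_mem_parity (i : ℕ) : x K i ∈ grassmannParity K 1 :=
  CliffordAlgebra.ι_mem_evenOdd_one _ _

theorem mul_mem_parity {a b c : ZMod 2} (h : a + b = c) {f g : Grassmann K}
    (hf : f ∈ grassmannParity K a) (hg : g ∈ grassmannParity K b) :
    f * g ∈ grassmannParity K c :=
  h ▸ SetLike.mul_mem_graded hf hg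

theorem mem_parity_of_mem_monomialLine {S : Finset ℕ} {f : Grassmann K}
    (hf : f ∈ monomialLine K S) : f ∈ grassmannParity K S.card := by
  refine monomialLine_induction (motive := fun S f => f ∈ grassmannParity K S.card)
    (fun a => ?_) (fun S j f hj hf ih => ?_) hf
  · rw [Finset.card_empty, Nat.cast_zero]
    exact SetLike.algebraMap_mem_graded (grassmannParity K) a
  · rw [Finset.card_insert_of_notMem hj, Nat.cast_add, Nat.cast_one, add_comm]
    exact mul_mem_parity rfl (x_mem_parity j) ih

end

/-! ### Superderivatives and pivot elements -/

section

variable {K : Type*} [Field K]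

theorem partialDeriv_one (i : ℕ) : partialDeriv K i 1 = 0 :=
  CliffordAlgebra.contractLeft_one _ _

theorem partialDeriv_x_mul (i j : ℕ) (f : Grassmann K) :
    partialDeriv K i (x K j * f) =
      (if j = i then 1 else 0 : K) • f - x K j * partialDeriv K i f := by
  have h := CliffordAlgebra.contractLeft_ι_mul (Q := (0 : QuadraticForm K (ℕ →₀ K)))
    (d := Finsupp.lapply i) (Finsupp.single j 1) f
  rwa [Finsupp.lapply_apply, Finsupp.single_apply] at h

theorem partialDeriv_x_mul_self (i : ℕ) (f : Grassmann K) :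
    partialDeriv K i (x K i * f) = f - x K i * partialDeriv K i f := by
  simp [partialDeriv_x_mul]

theorem partialDeriv_x_mul_of_ne {i j : ℕ} (h : j ≠ i) (f : Grassmann K) :
    partialDeriv K i (x K j * f) = - (x K j * partialDeriv K i f) := by
  simp [partialDeriv_x_mul, h]

theorem partialDeriv_partialDeriv_comm (i j : ℕ) (f : Grassmann K) :
    partialDeriv K i (partialDeriv K j f) = - partialDeriv K j (partialDeriv K i f) :=
  CliffordAlgebra.contractLeft_comm _ _ _

theorem partialDeriv_partialDeriv_self (i : ℕ) (f : Grassmann K) :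
    partialDeriv K i (partialDeriv K i f) = 0 :=
  CliffordAlgebra.contractLeft_contractLeft _ _

theorem partialDeriv_mem_parity (i : ℕ) {b : ZMod 2} {f : Grassmann K}
    (hf : f ∈ grassmannParity K b) : partialDeriv K i f ∈ grassmannParity K (1 + b) := by
  induction f, hf using CliffordAlgebra.evenOdd_induction with
  | range_ι_pow v h =>
    have hb : b = 0 ∨ b = 1 := by exact (by decide : ∀ b : ZMod 2, b = 0 ∨ b = 1) b
    rcases hb with rfl | rfl
    · rw [ZMod.val_zero, pow_zero, Submodule.mem_one] at h
      obtain ⟨a, rfl⟩ := h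
      rw [show partialDeriv K i (algebraMap K _ a) = 0 from
        CliffordAlgebra.contractLeft_algebraMap _ _ _]
      exact Submodule.zero_mem _
    · rw [show (1 : ZMod 2).val = 1 from rfl, pow_one] at h
      obtain ⟨m, rfl⟩ := h
      rw [show partialDeriv K i (CliffordAlgebra.ι 0 m) = algebraMap K _ (m i) from
        CliffordAlgebra.contractLeft_ι _ _ _]
      exact SetLike.algebraMap_mem_graded (grassmannParity K) _
  | add u v hu hv hu' hv' => rw [map_add]; exact Submodule.add_mem _ hu' hv'
  | ι_mul_ι_mul m₁ m₂ u hu hu' =>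
    have h := CliffordAlgebra.contractLeft_ι_mul (Q := (0 : QuadraticForm K (ℕ →₀ K)))
      (d := Finsupp.lapply i)
    have hm := fun m : ℕ →₀ K => CliffordAlgebra.ι_mem_evenOdd_one
      (0 : QuadraticForm K (ℕ →₀ K)) m
    rw [mul_assoc, partialDeriv, h, h, mul_sub, mul_smul_comm]
    have h2 : ∀ m, ∀ g ∈ grassmannParity K b,
        CliffordAlgebra.ι (0 : QuadraticForm K (ℕ →₀ K)) m * g ∈ grassmannParity K (1 + b) :=
      fun m g hg => mul_mem_parity rfl (hm m) hg
    have h3 : ∀ g ∈ grassmannParity K (1 + b),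
        CliffordAlgebra.ι (0 : QuadraticForm K (ℕ →₀ K)) m₁ *
          (CliffordAlgebra.ι (0 : QuadraticForm K (ℕ →₀ K)) m₂ * g)
            ∈ grassmannParity K (1 + b) := fun g hg =>
      mul_mem_parity (CharTwo.add_cancel_left 1 _) (hm m₁) (mul_mem_parity rfl (hm m₂) hg)
    exact Submodule.sub_mem _ (Submodule.smul_mem _ _ (h2 _ _ hu))
      (Submodule.sub_mem _ (Submodule.smul_mem _ _ (h2 _ _ hu)) (h3 _ hu'))

theorem pivotCoeff_mem_parity (n l : ℕ) : pivotCoeff K n l ∈ grassmannParity K 0 := by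
  induction l generalizing n with
  | zero => exact SetLike.one_mem_graded (grassmannParity K)
  | succ l ih =>
    exact mul_mem_parity (add_zero 0) (mul_mem_parity (by decide) (x_mem_parity n)
      (x_mem_parity (n + 1))) (ih (n + 3))

theorem pivotCoeff_mul_x (n l i : ℕ) : pivotCoeff K n l * x K i = x K i * pivotCoeff K n l := by
  induction l generalizing n with
  | zero => simp [pivotCoeff]
  | succ l ih =>
    rw [pivotCoeff, mul_assoc, ih, ← mul_assoc, ← mul_assoc, mul_assoc (x K n), x_mul_x_comm _ i,
      mul_neg, ← mul_assoc, x_mul_x_comm n i]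
    noncomm_ring

theorem partialDeriv_pivotCoeff_mul {i n : ℕ} (h : i < n) (l : ℕ) (f : Grassmann K) :
    partialDeriv K i (pivotCoeff K n l * f) = pivotCoeff K n l * partialDeriv K i f := by
  induction l generalizing n with
  | zero => simp [pivotCoeff]
  | succ l ih =>
    rw [pivotCoeff, mul_assoc, mul_assoc, partialDeriv_x_mul_of_ne (by omega),
      partialDeriv_x_mul_of_ne (by omega), ih (by omega), mul_neg, neg_neg, ← mul_assoc,
      ← mul_assoc]

/-- All sufficiently long finite sums compute the infinite sum that defines the pivot element. -/
theorem pivot_apply_eventually (n : ℕ) (f : Grassmann K) :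
    ∀ᶠ N in Filter.atTop, pivot K n f =
      ∑ l ∈ Finset.range N, pivotCoeff K n l * partialDeriv K (n + 3 * l) f := by
  obtain ⟨M, hM⟩ := (finite_support_pivotTerm (K := K) n f).bddAbove
  filter_upwards [Filter.eventually_gt_atTop M] with N hN
  refine finsum_eq_sum_of_support_subset _ fun l hl => ?_
  exact Finset.mem_coe.2 (Finset.mem_range.2 ((hM hl).trans_lt hN))

/-- The recursion `v_n = ∂_n + x_n x_{n+1} v_{n+3}`. -/
theorem pivot_apply (n : ℕ) (f : Grassmann K) :
    pivot K n f = partialDeriv K n f + x K n * (x K (n + 1) * pivot K (n + 3) f) := by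
  obtain ⟨N, h1, h2⟩ := (((Filter.tendsto_add_atTop_nat 1).eventually
    (pivot_apply_eventually n f)).and (pivot_apply_eventually (n + 3) f)).exists
  rw [h1, h2, Finset.sum_range_succ', add_comm]
  congr 1
  · simp [pivotCoeff]
  · rw [Finset.mul_sum, Finset.mul_sum]
    refine Finset.sum_congr rfl fun l _ => ?_
    rw [pivotCoeff, mul_assoc, mul_assoc, show n + 3 * (l + 1) = n + 3 + 3 * l by ring]

theorem pivot_one (n : ℕ) : pivot K n 1 = 0 := by
  obtain ⟨N, h⟩ := (pivot_apply_eventually (K := K) n 1).exists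
  simp [h, partialDeriv_one]

/-- The pivot elements are superderivations. -/
theorem pivot_x_mul (n i : ℕ) (f : Grassmann K) :
    pivot K n (x K i * f) = pivot K n (x K i) * f - x K i * pivot K n f := by
  obtain ⟨N, h1, h2, h3⟩ := ((pivot_apply_eventually n (x K i * f)).and
    ((pivot_apply_eventually n (x K i)).and (pivot_apply_eventually n f))).exists
  rw [h1, h2, h3, Finset.sum_mul, Finset.mul_sum, ← Finset.sum_sub_distrib]
  refine Finset.sum_congr rfl fun l _ => ?_
  have h := partialDeriv_x_mul (K := K) (n + 3 * l) i 1
  rw [mul_one, partialDeriv_one, mul_zero, sub_zero] at h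
  rw [partialDeriv_x_mul, h, mul_sub, ← mul_assoc, pivotCoeff_mul_x, mul_assoc (x K i)]
  simp

theorem pivot_partialDeriv {i n : ℕ} (h : i < n) (f : Grassmann K) :
    partialDeriv K i (pivot K n f) = - pivot K n (partialDeriv K i f) := by
  obtain ⟨N, h1, h2⟩ := ((pivot_apply_eventually n f).and
    (pivot_apply_eventually n (partialDeriv K i f))).exists
  rw [h1, h2, map_sum, ← Finset.sum_neg_distrib]
  refine Finset.sum_congr rfl fun l _ => ?_
  rw [partialDeriv_pivotCoeff_mul h, partialDeriv_partialDeriv_comm, mul_neg]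

theorem pivot_mem_endParity (n : ℕ) : pivot K n ∈ endParity K 1 := by
  intro b f hf
  obtain ⟨N, h⟩ := (pivot_apply_eventually (K := K) n f).exists
  rw [h]
  refine Submodule.sum_mem _ fun l _ => ?_
  exact mul_mem_parity (zero_add _) (pivotCoeff_mem_parity n l)
    (partialDeriv_mem_parity (n + 3 * l) hf)

theorem pivot_x_of_lt {i n : ℕ} (h : i < n) : pivot K n (x K i) = 0 := by
  obtain ⟨N, hN⟩ := (pivot_apply_eventually (K := K) n (x K i)).exists
  rw [hN]
  refine Finset.sum_eq_zero fun l _ => ?_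
  rw [← mul_one (x K i), partialDeriv_x_mul_of_ne (by omega), partialDeriv_one]
  simp

theorem pivot_x_self (n : ℕ) : pivot K n (x K n) = 1 := by
  rw [pivot_apply, pivot_x_of_lt (by omega), ← mul_one (x K n), partialDeriv_x_mul_self,
    partialDeriv_one]
  simp

theorem pivot_x_mul_of_lt {i n : ℕ} (h : i < n) (f : Grassmann K) :
    pivot K n (x K i * f) = - (x K i * pivot K n f) := by
  rw [pivot_x_mul, pivot_x_of_lt h, zero_mul, zero_sub]

theorem pivot_x_mul_self (n : ℕ) (f : Grassmann K) :
    pivot K n (x K n * f) = f - x K n * pivot K n f := by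
  rw [pivot_x_mul, pivot_x_self, one_mul]

theorem pivot_algebraMap (n : ℕ) (a : K) : pivot K n (algebraMap K _ a) = 0 := by
  rw [Algebra.algebraMap_eq_smul_one, map_smul, pivot_one, smul_zero]

theorem pivot_monomial_mul (n : ℕ) {S : Finset ℕ} {f : Grassmann K} (hf : f ∈ monomialLine K S)
    (g : Grassmann K) :
    pivot K n (f * g) = pivot K n f * g + (-1) ^ S.card * (f * pivot K n g) := by
  refine monomialLine_induction (motive := fun S f =>
    pivot K n (f * g) = pivot K n f * g + (-1) ^ S.card * (f * pivot K n g))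
    (fun a => ?_) (fun S j f hj hf ih => ?_) hf
  · rw [pivot_algebraMap, ← Algebra.smul_def, map_smul, Algebra.smul_def]
    simp
  · rw [mul_assoc, pivot_x_mul, ih, pivot_x_mul, Finset.card_insert_of_notMem hj, pow_succ]
    rcases neg_one_pow_eq_or (Grassmann K) S.card with h | h <;> simp only [h] <;> noncomm_ring

theorem pivot_monomial_of_lt {n : ℕ} {S : Finset ℕ} (hS : ∀ i ∈ S, i < n) {f : Grassmann K}
    (hf : f ∈ monomialLine K S) : pivot K n f = 0 := by
  revert hS
  refine monomialLine_induction (motive := fun S f => (∀ i ∈ S, i < n) → pivot K n f = 0)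
    (fun a _ => pivot_algebraMap n a) (fun S j f hj hf ih hS => ?_) hf
  rw [pivot_x_mul_of_lt (hS j (Finset.mem_insert_self _ _)),
    ih fun i hi => hS i (Finset.mem_insert_of_mem hi), mul_zero, neg_zero]

theorem pivot_monomial_mul_of_lt {n : ℕ} {S : Finset ℕ} (hS : ∀ i ∈ S, i < n) {f : Grassmann K}
    (hf : f ∈ monomialLine K S) (g : Grassmann K) :
    pivot K n (f * g) = (-1) ^ S.card * (f * pivot K n g) := by
  rw [pivot_monomial_mul n hf, pivot_monomial_of_lt hS hf, zero_mul, zero_add]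

theorem partialDeriv_monomial_of_notMem {n : ℕ} {S : Finset ℕ} (hS : n ∉ S) {f : Grassmann K}
    (hf : f ∈ monomialLine K S) : partialDeriv K n f = 0 := by
  revert hS
  refine monomialLine_induction (motive := fun S f => n ∉ S → partialDeriv K n f = 0)
    (fun a _ => ?_) (fun S j f hj hf ih hS => ?_) hf
  · rw [Algebra.algebraMap_eq_smul_one, map_smul, partialDeriv_one, smul_zero]
  · rw [Finset.mem_insert, not_or] at hS
    rw [partialDeriv_x_mul_of_ne (Ne.symm hS.1), ih hS.2, mul_zero, neg_zero]

/-- `v_n² = x_{n+1} v_{n+3}`. -/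
theorem pivot_pivot_self (n : ℕ) (f : Grassmann K) :
    pivot K n (pivot K n f) = x K (n + 1) * pivot K (n + 3) f := by
  have h1 : pivot K (n + 3) (x K n * (x K (n + 1) * pivot K (n + 3) f)) =
      x K n * (x K (n + 1) * pivot K (n + 3) (pivot K (n + 3) f)) := by
    rw [pivot_x_mul_of_lt (by omega), pivot_x_mul_of_lt (by omega), mul_neg, neg_neg]
  have h2 : x K n * (x K (n + 1) * (x K n * (x K (n + 1) *
      pivot K (n + 3) (pivot K (n + 3) f)))) = 0 := by
    rw [← mul_assoc (x K (n + 1)), x_mul_x_comm (n + 1) n, neg_mul, mul_neg, mul_assoc,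
      x_mul_x_mul_self, neg_zero]
  rw [pivot_apply n (pivot K n f), pivot_apply n f, map_add, map_add, h1, mul_add, mul_add, h2,
    partialDeriv_partialDeriv_self, partialDeriv_x_mul_self,
    partialDeriv_x_mul_of_ne (by omega), pivot_partialDeriv (by omega)]
  noncomm_ring

variable (K) in
/-- The anticommutator `v_n v_m + v_m v_n`, which is the supercommutator of the odd operators `v_n`
and `v_m`. -/
noncomputable def pivotAnticomm (n m : ℕ) : Module.End K (Grassmann K) :=
  pivot K n * pivot K m + pivot K m * pivot K n

theorem pivotAnticomm_comm (n m : ℕ) : pivotAnticomm K n m = pivotAnticomm K m n :=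
  add_comm _ _

theorem pivotAnticomm_self (n : ℕ) (f : Grassmann K) :
    pivotAnticomm K n n f = (2 : K) • (x K (n + 1) * pivot K (n + 3) f) := by
  simp only [pivotAnticomm, LinearMap.add_apply, Module.End.mul_apply, pivot_pivot_self]
  rw [two_smul]

theorem pivotAnticomm_of_add_two_le {n m : ℕ} (h : n + 2 ≤ m) (f : Grassmann K) :
    pivotAnticomm K n m f = x K n * (x K (n + 1) * pivotAnticomm K (n + 3) m f) := by
  simp only [pivotAnticomm, LinearMap.add_apply, Module.End.mul_apply]
  rw [pivot_apply n, pivot_apply n, map_add, pivot_partialDeriv (by omega),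
    pivot_x_mul_of_lt (by omega), pivot_x_mul_of_lt (by omega)]
  noncomm_ring

theorem pivotAnticomm_succ (n : ℕ) (f : Grassmann K) :
    pivotAnticomm K n (n + 1) f = - (x K n * pivot K (n + 3) f) := by
  have h : x K (n + 1) * pivotAnticomm K (n + 1) (n + 3) f = 0 := by
    rw [pivotAnticomm_of_add_two_le (by omega), x_mul_x_mul_self]
  simp only [pivotAnticomm, LinearMap.add_apply, Module.End.mul_apply] at h ⊢
  rw [mul_add, add_eq_zero_iff_eq_neg'] at h
  rw [pivot_apply n, pivot_apply n, map_add, pivot_partialDeriv (by omega),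
    pivot_x_mul_of_lt (by omega), pivot_x_mul_self, h]
  noncomm_ring

/-- `{v_n, v_m}` is divisible by `x_n` when `n < m`. -/
theorem x_mul_pivotAnticomm {n m : ℕ} (h : n < m) (f : Grassmann K) :
    x K n * pivotAnticomm K n m f = 0 := by
  obtain rfl | h := Nat.eq_or_lt_of_le (Nat.succ_le_of_lt h)
  · rw [Nat.succ_eq_add_one, pivotAnticomm_succ, mul_neg, x_mul_x_mul_self, neg_zero]
  · rw [pivotAnticomm_of_add_two_le (by omega), x_mul_x_mul_self]

end

/-! ### The supercommutator -/

section

variable {K : Type*} [Field K]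

theorem parityPart_of_mem {c : ZMod 2} {φ : Module.End K (Grassmann K)} (hφ : φ ∈ endParity K c)
    (a : ZMod 2) : parityPart a φ = if a = c then φ else 0 := by
  classical
  refine LinearMap.ext fun f => ?_
  have h : ∀ b, GradedAlgebra.proj (grassmannParity K) (a + b)
      (φ (GradedAlgebra.proj (grassmannParity K) b f)) =
      if a = c then φ (GradedAlgebra.proj (grassmannParity K) b f) else 0 := fun b => by
    have hb := hφ b (GradedAlgebra.proj (grassmannParity K) b f) (SetLike.coe_mem _)
    split_ifs with hac
    · subst hac
      exact DirectSum.decompose_of_mem_same _ hb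
    · exact DirectSum.decompose_of_mem_ne _ hb fun h => hac (add_right_cancel h).symm
  simp only [parityPart, LinearMap.sum_apply, LinearMap.comp_apply, h]
  split_ifs
  · rw [← map_sum]
    congr 1
    conv_rhs => rw [← DirectSum.sum_support_decompose (grassmannParity K) f]
    refine (Finset.sum_subset (Finset.subset_univ _) fun b _ hb => ?_).symm
    simpa using hb
  · simp

/-- The supercommutator of homogeneous operators. -/
theorem superBracket_of_mem {a b : ZMod 2} {φ ψ : Module.End K (Grassmann K)}
    (hφ : φ ∈ endParity K a) (hψ : ψ ∈ endParity K b) :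
    superBracket φ ψ = φ * ψ - (-1 : K) ^ (a.val * b.val) • (ψ * φ) := by
  rw [superBracket, Finset.sum_eq_single a, Finset.sum_eq_single b]
  · simp [parityPart_of_mem hφ, parityPart_of_mem hψ]
  · intro b' _ hb'
    simp [parityPart_of_mem hψ, hb']
  · simp
  · intro a' _ ha'
    simp [parityPart_of_mem hφ, ha']
  · simp

theorem superBracket_comm_of_mem {a b : ZMod 2} {φ ψ : Module.End K (Grassmann K)}
    (hφ : φ ∈ endParity K a) (hψ : ψ ∈ endParity K b) :
    superBracket ψ φ = - (-1 : K) ^ (a.val * b.val) • superBracket φ ψ := by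
  rw [superBracket_of_mem hφ hψ, superBracket_of_mem hψ hφ, mul_comm b.val]
  rcases neg_one_pow_eq_or K (a.val * b.val) with h | h <;> rw [h] <;> module

theorem parityPart_add (a : ZMod 2) (φ ψ : Module.End K (Grassmann K)) :
    parityPart a (φ + ψ) = parityPart a φ + parityPart a ψ := by
  simp only [parityPart, LinearMap.add_comp, LinearMap.comp_add, Finset.sum_add_distrib]

theorem parityPart_smul (a : ZMod 2) (c : K) (φ : Module.End K (Grassmann K)) :
    parityPart a (c • φ) = c • parityPart a φ := by
  simp only [parityPart, LinearMap.smul_comp, LinearMap.comp_smul, Finset.smul_sum]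

variable (K) in
/-- The projection of `End Λ` onto its component of parity `a`, as a linear map. -/
noncomputable def parityPartHom (a : ZMod 2) :
    Module.End K (Grassmann K) →ₗ[K] Module.End K (Grassmann K) where
  toFun := parityPart a
  map_add' := parityPart_add a
  map_smul' := parityPart_smul a

variable (K) in
/-- The supercommutator on `End Λ` as a bilinear map. -/
noncomputable def superBracketHom : Module.End K (Grassmann K) →ₗ[K]
    Module.End K (Grassmann K) →ₗ[K] Module.End K (Grassmann K) :=
  LinearMap.mk₂ K superBracket
    (fun φ φ' ψ => by
      simp only [superBracket, parityPart_add, ← Finset.sum_add_distrib, add_mul, mul_add,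
        smul_add]
      exact Finset.sum_congr rfl fun _ _ => Finset.sum_congr rfl fun _ _ => by abel)
    (fun c φ ψ => by
      simp only [superBracket, parityPart_smul, Finset.smul_sum, smul_mul_assoc, mul_smul_comm,
        smul_sub]
      exact Finset.sum_congr rfl fun _ _ => Finset.sum_congr rfl fun _ _ => by
        rw [smul_comm c])
    (fun φ ψ ψ' => by
      simp only [superBracket, parityPart_add, ← Finset.sum_add_distrib, add_mul, mul_add,
        smul_add]
      exact Finset.sum_congr rfl fun _ _ => Finset.sum_congr rfl fun _ _ => by abel)
    (fun c φ ψ => by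
      simp only [superBracket, parityPart_smul, Finset.smul_sum, smul_mul_assoc, mul_smul_comm,
        smul_sub]
      exact Finset.sum_congr rfl fun _ _ => Finset.sum_congr rfl fun _ _ => by
        rw [smul_comm c])

/-- The operator `f v_n` on `Λ`. -/
noncomputable def pivotMul (f : Grassmann K) (n : ℕ) : Module.End K (Grassmann K) :=
  LinearMap.mulLeft K f * pivot K n

@[simp]
theorem pivotMul_apply (f : Grassmann K) (n : ℕ) (g : Grassmann K) :
    pivotMul f n g = f * pivot K n g := rfl

theorem pivotMul_one (n : ℕ) : pivotMul 1 n = pivot K n := by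
  exact LinearMap.ext fun g => one_mul _

theorem pivotMul_mem_endParity {S : Finset ℕ} {f : Grassmann K} (hf : f ∈ monomialLine K S)
    (n : ℕ) : pivotMul f n ∈ endParity K (S.card + 1) := fun b _ hg =>
  mul_mem_parity (add_assoc _ _ _).symm (mem_parity_of_mem_monomialLine hf)
    (pivot_mem_endParity n b _ hg)

/-- The supercommutator of `f v_n` and `g v_m` for monomials `f`, `g` such that `f` only involves
letters killed by `v_m`. -/
theorem superBracket_pivotMul {S T : Finset ℕ} {f g : Grassmann K} (hf : f ∈ monomialLine K S)
    (hg : g ∈ monomialLine K T) (n : ℕ) {m : ℕ} (hS : ∀ i ∈ S, i < m) (h : Grassmann K) :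
    superBracket (pivotMul f n) (pivotMul g m) h =
      f * pivot K n g * pivot K m h + (-1) ^ T.card * (f * (g * pivotAnticomm K n m h)) := by
  rw [superBracket_of_mem (pivotMul_mem_endParity hf n) (pivotMul_mem_endParity hg m)]
  simp only [LinearMap.sub_apply, LinearMap.smul_apply, Module.End.mul_apply, pivotMul_apply,
    pivotAnticomm, LinearMap.add_apply]
  rw [pivot_monomial_mul n hg, pivot_monomial_mul_of_lt hS hf]
  have h1 : ∀ u, g * (f * u) = (-1) ^ (S.card * T.card) * (f * (g * u)) := fun u => by
    rw [← mul_assoc, monomial_mul_comm hf hg, mul_assoc, mul_assoc]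
  have hv : ∀ k : ℕ, (Even k → ((k : ZMod 2) + 1).val = 1) ∧ (Odd k → ((k : ZMod 2) + 1).val = 0) :=
    fun k => ⟨fun hk => by rw [(ZMod.natCast_eq_zero_iff_even).2 hk]; rfl,
      fun hk => by rw [(ZMod.natCast_eq_one_iff_odd).2 hk]; rfl⟩
  rcases Nat.even_or_odd S.card with hs | hs <;> rcases Nat.even_or_odd T.card with ht | ht
  · rw [(hv _).1 hs, (hv _).1 ht, hs.neg_one_pow, ht.neg_one_pow, one_mul (f * _), h1,
      (hs.mul_right _).neg_one_pow]
    simp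
    noncomm_ring
  · rw [(hv _).1 hs, (hv _).2 ht, hs.neg_one_pow, ht.neg_one_pow, one_mul (f * _), h1,
      (hs.mul_right _).neg_one_pow]
    simp
    noncomm_ring
  · rw [(hv _).2 hs, (hv _).1 ht, hs.neg_one_pow, ht.neg_one_pow, neg_one_mul, mul_neg, h1,
      (ht.mul_left _).neg_one_pow]
    simp
    noncomm_ring
  · rw [(hv _).2 hs, (hv _).2 ht, hs.neg_one_pow, ht.neg_one_pow, neg_one_mul, neg_one_mul,
      mul_neg g, h1, (hs.mul ht).neg_one_pow]
    simp
    noncomm_ring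

end

/-! ### Weights of standard monomials -/

/-- The multidegree of the pivot element `v_n`: the unit vectors for `n < 3`, and
`wt v_{n+3} = 2 wt v_n + wt v_{n+1}` since `v_n` and `x_n x_{n+1} v_{n+3}` have the same weight
when `x_i` is given the weight `- wt v_i`. -/
def pivotWeight : ℕ → Fin 3 → ℕ
  | 0 => Pi.single 0 1
  | 1 => Pi.single 1 1
  | 2 => Pi.single 2 1
  | n + 3 => 2 • pivotWeight n + pivotWeight (n + 1)

theorem pivotWeight_add_three (n : ℕ) :
    pivotWeight (n + 3) = 2 • pivotWeight n + pivotWeight (n + 1) := by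
  rw [pivotWeight]

/-- Multiplication by `λ` in `ℤ[λ]/(λ³ - λ - 2)`, in the basis `1, λ, λ²`. The weight of `v_n` is
`λⁿ`. -/
def weightShift : (Fin 3 → ℕ) →+ (Fin 3 → ℕ) where
  toFun a := ![2 * a 2, a 0 + a 2, a 1]
  map_zero' := by ext i; fin_cases i <;> rfl
  map_add' a b := by ext i; fin_cases i <;> simp <;> ring

theorem weightShift_injective : Function.Injective weightShift := by
  intro a b h
  have h0 := congrFun h 0
  have h1 := congrFun h 1
  have h2 := congrFun h 2
  simp [weightShift] at h0 h1 h2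
  ext i
  fin_cases i <;> simp <;> omega

theorem even_weightShift_zero (a : Fin 3 → ℕ) : Even (weightShift a 0) :=
  even_two_mul _

theorem weightShift_pivotWeight (n : ℕ) : weightShift (pivotWeight n) = pivotWeight (n + 1) := by
  induction n using pivotWeight.induct with
  | case1 => ext i; fin_cases i <;> rfl
  | case2 => ext i; fin_cases i <;> rfl
  | case3 => ext i; fin_cases i <;> rfl
  | case4 n h0 h1 => rw [pivotWeight, map_add, map_nsmul, h0, h1, ← pivotWeight_add_three]

/-- The pairs `(n, S)` for which `x_S v_n` can occur in the Lie superalgebra `Q`. All letters of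
`S` precede `x_{n-1}`, and `S` does not contain both `n - 3` and `n - 2`; the latter excludes one
of the two monomials `x_S v_n` and `x_S x_n x_{n+1} v_{n+3}` of equal weight. -/
structure IsStandard (n : ℕ) (S : Finset ℕ) : Prop where
  add_two_le : ∀ i ∈ S, i + 2 ≤ n
  not_both : ∀ i, i + 3 = n → ¬ (i ∈ S ∧ i + 1 ∈ S)

/-- The set `{i | i + 1 ∈ S}`: the digits of `S` without the zeroth one. -/
noncomputable def digitShift (S : Finset ℕ) : Finset ℕ :=
  S.preimage Nat.succ Nat.succ_injective.injOn

theorem mem_digitShift {S : Finset ℕ} {i : ℕ} : i ∈ digitShift S ↔ i + 1 ∈ S := by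
  simp [digitShift]

theorem sum_pivotWeight (S : Finset ℕ) :
    ∑ i ∈ S, pivotWeight i =
      (if 0 ∈ S then pivotWeight 0 else 0) + weightShift (∑ i ∈ digitShift S, pivotWeight i) := by
  have h : S.erase 0 = (digitShift S).map ⟨Nat.succ, Nat.succ_injective⟩ := by
    ext i
    cases i <;> simp [mem_digitShift]
  have h2 : ∑ i ∈ S.erase 0, pivotWeight i = weightShift (∑ i ∈ digitShift S, pivotWeight i) := by
    rw [h, Finset.sum_map, map_sum]
    exact Finset.sum_congr rfl fun i _ => (weightShift_pivotWeight i).symm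
  rw [← h2]
  split_ifs with h0
  · rw [Finset.add_sum_erase _ _ h0]
  · rw [Finset.erase_eq_of_notMem h0, zero_add]

/-- The first digit is determined by the parity of the first coordinate. -/
theorem digit_cancel {p q : Prop} [Decidable p] [Decidable q] {a b : Fin 3 → ℕ}
    (h : (if p then pivotWeight 0 else 0) + weightShift a =
      (if q then pivotWeight 0 else 0) + weightShift b) : (p ↔ q) ∧ a = b := by
  have h0 := congrFun h 0
  obtain ⟨u, hu⟩ := even_weightShift_zero a
  obtain ⟨v, hv⟩ := even_weightShift_zero b
  have hpq : p ↔ q := by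
    by_cases hp : p <;> by_cases hq : q <;> simp [hp, hq, pivotWeight, hu, hv] at h0 ⊢ <;> omega
  refine ⟨hpq, weightShift_injective ?_⟩
  simp only [hpq] at h
  exact add_left_cancel h

theorem IsStandard.digitShift {n : ℕ} {S : Finset ℕ} (h : IsStandard (n + 1) S) :
    IsStandard n (digitShift S) where
  add_two_le i hi := by
    have := h.add_two_le _ (mem_digitShift.1 hi)
    omega
  not_both i hi hS := h.not_both (i + 1) (by omega)
    ⟨mem_digitShift.1 hS.1, mem_digitShift.1 hS.2⟩

theorem IsStandard.eq_empty {n : ℕ} {S : Finset ℕ} (h : IsStandard n S) (hn : n ≤ 1) : S = ∅ :=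
  Finset.eq_empty_of_forall_notMem fun i hi => by
    have := h.add_two_le i hi
    omega

/-- `1 = λᵐ - ∑_{i ∈ T} λⁱ` has no standard solution with `m > 0`: comparing digits forces `T` to
begin with `0, 1` and not to contain `2`, after which the same equation holds for `m - 3`. -/
theorem eq_zero_of_weight_eq (m : ℕ) : ∀ {T : Finset ℕ}, IsStandard m T →
    pivotWeight 0 + ∑ i ∈ T, pivotWeight i = pivotWeight m → m = 0 := by
  induction m using Nat.strong_induction_on with
  | _ m ih =>
  intro T hT h
  by_contra hm
  obtain ⟨k, rfl⟩ := Nat.exists_eq_succ_of_ne_zero hm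
  have h0 : 0 ∈ T := by
    by_contra h0
    have := digit_cancel (p := True) (q := False) (a := ∑ i ∈ digitShift T, pivotWeight i)
      (b := pivotWeight k) (by
        rw [weightShift_pivotWeight, if_pos trivial, if_neg id, zero_add, ← h, sum_pivotWeight T,
          if_neg h0, zero_add])
    simp at this
  have hk : 1 ≤ k := by have := hT.add_two_le 0 h0; omega
  obtain ⟨k, rfl⟩ := Nat.exists_eq_add_of_le' hk
  -- `2 + ⋯ = λᵐ` becomes `λ² + ⋯ = λ^{m-1} + 1` after adding `λ` to both sides and
  -- dividing by `λ`
  have h1 : pivotWeight 2 + ∑ i ∈ digitShift T, pivotWeight i =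
      pivotWeight (k + 1) + pivotWeight 0 := by
    apply weightShift_injective
    rw [map_add, map_add, weightShift_pivotWeight, weightShift_pivotWeight,
      weightShift_pivotWeight, ← Nat.succ_eq_add_one (k + 1), ← h, sum_pivotWeight T, if_pos h0,
      pivotWeight_add_three, two_smul]
    abel
  rw [sum_pivotWeight, ← weightShift_pivotWeight k, ← weightShift_pivotWeight 1] at h1
  obtain ⟨hp, h2⟩ := digit_cancel (p := 0 ∈ digitShift T) (q := True)
    (a := pivotWeight 1 + ∑ i ∈ digitShift (digitShift T), pivotWeight i)
    (b := pivotWeight k) (by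
      rw [if_pos trivial, map_add, add_comm (pivotWeight 0) (weightShift (pivotWeight k)), ← h1]
      abel)
  have h1T : 1 ∈ T := mem_digitShift.1 (hp.2 trivial)
  have hk : 1 ≤ k := by have := hT.add_two_le 1 h1T; omega
  obtain ⟨k, rfl⟩ := Nat.exists_eq_add_of_le' hk
  rw [sum_pivotWeight, ← weightShift_pivotWeight k, ← weightShift_pivotWeight 0] at h2
  obtain ⟨-, h3⟩ := digit_cancel (p := 0 ∈ digitShift (digitShift T)) (q := False)
    (a := pivotWeight 0 + ∑ i ∈ digitShift (digitShift (digitShift T)), pivotWeight i)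
    (b := pivotWeight k) (by
      rw [if_neg id, zero_add, map_add, ← h2]
      abel)
  have hk0 := ih k (by omega) hT.digitShift.digitShift.digitShift h3
  subst hk0
  exact hT.not_both 0 rfl ⟨h0, h1T⟩

/-- A standard pair is determined by its weight `λⁿ - ∑_{i ∈ S} λⁱ`: the elements of `S` are the
digits in base `λ`, an element of norm `2`. -/
theorem IsStandard.eq_of_weight_eq {n m : ℕ} {S T : Finset ℕ} (hS : IsStandard n S)
    (hT : IsStandard m T)
    (h : pivotWeight n + ∑ i ∈ T, pivotWeight i = pivotWeight m + ∑ i ∈ S, pivotWeight i) :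
    n = m ∧ S = T := by
  induction n generalizing m S T with
  | zero =>
    rw [hS.eq_empty zero_le_one, Finset.sum_empty, add_zero] at h
    obtain rfl := eq_zero_of_weight_eq m hT h
    exact ⟨rfl, (hS.eq_empty zero_le_one).trans (hT.eq_empty zero_le_one).symm⟩
  | succ n ih =>
    cases m with
    | zero =>
      rw [hT.eq_empty zero_le_one, Finset.sum_empty, add_zero] at h
      exact absurd (eq_zero_of_weight_eq _ hS h.symm) (Nat.succ_ne_zero n)
    | succ m =>
      rw [sum_pivotWeight, sum_pivotWeight S, ← weightShift_pivotWeight, ← weightShift_pivotWeight,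
        add_left_comm, add_left_comm (weightShift (pivotWeight m)), ← map_add, ← map_add] at h
      obtain ⟨h0, h1⟩ := digit_cancel h
      obtain ⟨rfl, h2⟩ := ih hS.digitShift hT.digitShift h1
      refine ⟨rfl, Finset.ext fun i => ?_⟩
      cases i with
      | zero => exact h0.symm
      | succ i => rw [← mem_digitShift, h2, mem_digitShift]

/-! ### Lie products are multiples of standard monomials -/

section

variable {K : Type*} [Field K]

/-- `IsStandardMultiple d φ`: the operator `φ` is a scalar multiple of a standard monomial
`x_S v_n` of weight `d`; the scalar may be zero. -/
def IsStandardMultiple (d : Fin 3 → ℕ) (φ : Module.End K (Grassmann K)) : Prop :=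
  φ = 0 ∨ ∃ (n : ℕ) (S : Finset ℕ) (f : Grassmann K), IsStandard n S ∧
    d + ∑ i ∈ S, pivotWeight i = pivotWeight n ∧ f ∈ monomialLine K S ∧ φ = pivotMul f n

theorem IsStandardMultiple.smul {d : Fin 3 → ℕ} {φ : Module.End K (Grassmann K)}
    (h : IsStandardMultiple d φ) (c : K) : IsStandardMultiple d (c • φ) := by
  rcases h with rfl | ⟨n, S, f, hS, hd, hf, rfl⟩
  · exact Or.inl (smul_zero c)
  · refine Or.inr ⟨n, S, c • f, hS, hd, Submodule.smul_mem _ c hf, LinearMap.ext fun g => ?_⟩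
    simp

theorem mul_x_mem_monomialLine {S : Finset ℕ} {i : ℕ} (h : i ∉ S) {f : Grassmann K}
    (hf : f ∈ monomialLine K S) : f * x K i ∈ monomialLine K (insert i S) := by
  rw [Finset.insert_eq, Finset.union_comm]
  exact mul_mem_monomialLine (by simpa using h) hf (x_mem_monomialLine i)

/-- A monomial `f x_i`, when nonzero, involves one letter more than `f`. -/
theorem mul_x_cases {S : Finset ℕ} {f : Grassmann K} (hf : f ∈ monomialLine K S) (i : ℕ) :
    f * x K i = 0 ∨ i ∉ S ∧ f * x K i ∈ monomialLine K (insert i S) := by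
  by_cases h : i ∈ S
  · exact Or.inl (mul_x_eq_zero h hf)
  · exact Or.inr ⟨h, mul_x_mem_monomialLine h hf⟩

theorem mul_cases {S T : Finset ℕ} {f g : Grassmann K} (hf : f ∈ monomialLine K S)
    (hg : g ∈ monomialLine K T) :
    f * g = 0 ∨ Disjoint S T ∧ f * g ∈ monomialLine K (S ∪ T) := by
  by_cases h : Disjoint S T
  · exact Or.inr ⟨h, mul_mem_monomialLine h hf hg⟩
  · exact Or.inl (mul_eq_zero_of_not_disjoint h hf hg)

/-- The operator `f v_n²` for a monomial `f`. -/
theorem isStandardMultiple_mul_sq {n : ℕ} {R : Finset ℕ} {f : Grassmann K}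
    (hf : f ∈ monomialLine K R) (hR : ∀ i ∈ R, i + 2 ≤ n) {d : Fin 3 → ℕ}
    (hd : d + ∑ i ∈ R, pivotWeight i = 2 • pivotWeight n) :
    IsStandardMultiple d (pivotMul (f * x K (n + 1)) (n + 3)) := by
  rcases mul_x_cases hf (n + 1) with h | ⟨h, hm⟩
  · exact Or.inl (LinearMap.ext fun g => by simp [h])
  refine Or.inr ⟨_, _, _, ⟨fun i hi => ?_, fun i hi hS => ?_⟩, ?_, hm, rfl⟩
  · rcases Finset.mem_insert.1 hi with rfl | hi
    · omega
    · have := hR i hi; omega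
  · obtain rfl : i = n := by omega
    rcases Finset.mem_insert.1 hS.1 with h | h
    · omega
    · have := hR i h; omega
  · rw [Finset.sum_insert h, add_left_comm, hd, add_comm, pivotWeight_add_three]

/-- The operator `f {v_n, v_m}` for a monomial `f` is a multiple of a standard monomial. -/
theorem isStandardMultiple_mul_pivotAnticomm {n m : ℕ} (hnm : n ≤ m) {R : Finset ℕ}
    {f : Grassmann K} (hf : f ∈ monomialLine K R) (hR : ∀ i ∈ R, i + 2 ≤ m) {d : Fin 3 → ℕ}
    (hd : d + ∑ i ∈ R, pivotWeight i = pivotWeight n + pivotWeight m) :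
    IsStandardMultiple d (LinearMap.mulLeft K f * pivotAnticomm K n m) := by
  obtain ⟨k, hk⟩ := Nat.exists_eq_add_of_le hnm
  induction k using Nat.strong_induction_on generalizing n R f with
  | _ k ih =>
  obtain rfl | rfl | rfl | h3 : k = 0 ∨ k = 1 ∨ k = 2 ∨ 3 ≤ k := by omega
  · obtain rfl : m = n := by omega
    convert (isStandardMultiple_mul_sq hf hR (d := d) (by rw [hd, two_smul])).smul 2 using 1
    refine LinearMap.ext fun g => ?_
    simp [pivotAnticomm_self, mul_assoc]
  · subst hk
    have hφ : LinearMap.mulLeft K f * pivotAnticomm K n (n + 1) =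
        pivotMul (- (f * x K n)) (n + 3) := LinearMap.ext fun g => by
      simp [pivotAnticomm_succ, mul_assoc]
    rw [hφ]
    rcases mul_x_cases hf n with h | ⟨h, hm⟩
    · exact Or.inl (LinearMap.ext fun g => by simp [h])
    refine Or.inr ⟨_, _, _, ⟨fun i hi => ?_, fun i hi hS => ?_⟩, ?_, Submodule.neg_mem _ hm, rfl⟩
    · rcases Finset.mem_insert.1 hi with rfl | hi
      · omega
      · have := hR i hi; omega
    · rcases Finset.mem_insert.1 hS.2 with h | h
      · omega
      · have := hR _ h; omega
    · rw [Finset.sum_insert h, add_left_comm, hd, pivotWeight_add_three, two_smul, add_assoc]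
  · subst hk
    have hφ : LinearMap.mulLeft K f * pivotAnticomm K n (n + 2) =
        pivotMul (- (f * x K n * x K (n + 1) * x K (n + 2))) (n + 5) := LinearMap.ext fun g => by
      simp [pivotAnticomm_of_add_two_le, pivotAnticomm_comm (n + 3), pivotAnticomm_succ, mul_assoc]
    rw [hφ]
    rcases mul_x_cases hf n with h | ⟨h, hm⟩
    · exact Or.inl (LinearMap.ext fun g => by simp [h])
    rcases mul_x_cases hm (n + 1) with h' | ⟨h', hm'⟩
    · exact Or.inl (LinearMap.ext fun g => by simp [h'])
    rcases mul_x_cases hm' (n + 2) with h'' | ⟨h'', hm''⟩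
    · exact Or.inl (LinearMap.ext fun g => by simp [h''])
    refine Or.inr ⟨_, _, _, ⟨fun i hi => ?_, fun i hi hS => ?_⟩, ?_, Submodule.neg_mem _ hm'', rfl⟩
    · simp only [Finset.mem_insert] at hi
      rcases hi with rfl | rfl | rfl | hi
      · omega
      · omega
      · omega
      · have := hR i hi; omega
    · obtain rfl : i = n + 2 := by omega
      have hi := hS.2
      simp only [Finset.mem_insert] at hi
      rcases hi with hi | hi | hi | hi
      · omega
      · omega
      · omega
      · have := hR _ hi; omega
    · rw [Finset.sum_insert h'', Finset.sum_insert h', Finset.sum_insert h,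
        show n + 5 = n + 2 + 3 from rfl, pivotWeight_add_three (n + 2),
        show n + 2 + 1 = n + 3 from rfl, pivotWeight_add_three n]
      rw [show ∀ a b c e : Fin 3 → ℕ, d + (a + (b + (c + e))) = a + b + c + (d + e) from
        fun a b c e => by abel, hd]
      abel
  · have hφ : LinearMap.mulLeft K f * pivotAnticomm K n m =
        LinearMap.mulLeft K (f * x K n * x K (n + 1)) * pivotAnticomm K (n + 3) m :=
      LinearMap.ext fun g => by
        simp [pivotAnticomm_of_add_two_le (show n + 2 ≤ m by omega), mul_assoc]
    rw [hφ]
    rcases mul_x_cases hf n with h | ⟨h, hm⟩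
    · exact Or.inl (LinearMap.ext fun g => by simp [h])
    rcases mul_x_cases hm (n + 1) with h' | ⟨h', hm'⟩
    · exact Or.inl (LinearMap.ext fun g => by simp [h'])
    refine ih (k - 3) (by omega) (by omega) hm' (fun i hi => ?_) ?_ (by omega)
    · simp only [Finset.mem_insert] at hi
      rcases hi with rfl | rfl | hi
      · omega
      · omega
      · exact hR i hi
    · rw [Finset.sum_insert h', Finset.sum_insert h, pivotWeight_add_three n]
      rw [show ∀ a b e : Fin 3 → ℕ, d + (a + (b + e)) = a + b + (d + e) from
        fun a b e => by abel, hd]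
      abel

/-- A pivot element maps a monomial to a multiple of a monomial: only the first term of `v_n` whose
derivative does not vanish survives. New letters precede an old one by at least two. -/
theorem pivot_monomial_cases (n : ℕ) {T : Finset ℕ} {f : Grassmann K}
    (hf : f ∈ monomialLine K T) : pivot K n f = 0 ∨ ∃ U, pivot K n f ∈ monomialLine K U ∧
      ∑ i ∈ T, pivotWeight i = ∑ i ∈ U, pivotWeight i + pivotWeight n ∧
      ∀ i ∈ U, i ∈ T ∨ ∃ t ∈ T, i + 2 ≤ t := by
  obtain ⟨k, hk⟩ : ∃ k, ∀ t ∈ T, t < n + k :=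
    ⟨T.sup id + 1, fun t ht => by have := Finset.le_sup (f := id) ht; simp at this; omega⟩
  induction k generalizing n with
  | zero => exact Or.inl (pivot_monomial_of_lt hk hf)
  | succ k ih =>
    by_cases hn : n ∈ T
    · right
      obtain ⟨g, hg, rfl⟩ := exists_eq_x_mul hn hf
      have h : pivot K n (x K n * g) = g := by
        rw [pivot_apply, partialDeriv_x_mul_self,
          partialDeriv_monomial_of_notMem (Finset.notMem_erase n T) hg,
          pivot_x_mul_of_lt (by omega), mul_neg, ← mul_assoc (x K (n + 1)),
          x_mul_x_comm (n + 1) n, mul_neg, ← mul_neg, neg_mul, neg_neg, mul_assoc,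
          x_mul_x_mul_self]
        simp
      rw [h]
      exact ⟨T.erase n, hg, (Finset.sum_erase_add _ _ hn).symm,
        fun i hi => Or.inl (Finset.mem_of_mem_erase hi)⟩
    · have h : pivot K n f = x K n * (x K (n + 1) * pivot K (n + 3) f) := by
        rw [pivot_apply, partialDeriv_monomial_of_notMem hn hf, zero_add]
      rw [h]
      by_cases hT : ∃ t ∈ T, n + 3 ≤ t
      swap
      · push Not at hT
        rw [pivot_monomial_of_lt hT hf]
        simp
      obtain ⟨t, ht, hnt⟩ := hT
      rcases ih (n + 3) (fun t ht => by have := hk t ht; omega) with h0 | ⟨U, hU, hw, hUT⟩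
      · simp [h0]
      by_cases h1 : n + 1 ∈ U
      · simp [x_mul_eq_zero h1 hU]
      have hU1 := x_mul_mem_monomialLine h1 hU
      by_cases h2 : n ∈ insert (n + 1) U
      · simp [x_mul_eq_zero h2 hU1]
      refine Or.inr ⟨_, x_mul_mem_monomialLine h2 hU1, ?_, fun i hi => ?_⟩
      · rw [hw, Finset.sum_insert h2, Finset.sum_insert h1, pivotWeight_add_three]
        abel
      · simp only [Finset.mem_insert] at hi
        rcases hi with rfl | rfl | hi
        · exact Or.inr ⟨t, ht, by omega⟩
        · exact Or.inr ⟨t, ht, by omega⟩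
        · exact hUT i hi

/-- Two contributions to the supercommutator of `x_S v_n` and `x_T v_m` exclude each other. -/
theorem pivot_eq_zero_or_mul_pivotAnticomm_eq_zero {n m : ℕ} (hnm : n < m) {T : Finset ℕ}
    {f : Grassmann K} (hf : f ∈ monomialLine K T) (hT : ∀ i ∈ T, i < m) :
    pivot K n f = 0 ∨ ∀ h, f * pivotAnticomm K n m h = 0 := by
  obtain ⟨k, hk⟩ := Nat.exists_eq_add_of_lt hnm
  induction k using Nat.strong_induction_on generalizing n with
  | _ k ih =>
  have hc := x_mul_comm hf
  by_cases hn : n ∈ T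
  · right
    intro h
    obtain ⟨g, hg, rfl⟩ := exists_eq_x_mul hn hf
    have := x_mul_comm hg n
    rcases neg_one_pow_eq_or (Grassmann K) (T.erase n).card with h' | h' <;> rw [h'] at this
    · rw [one_mul] at this
      rw [← this, mul_assoc, x_mul_pivotAnticomm hnm, mul_zero]
    · rw [neg_one_mul, eq_neg_iff_add_eq_zero, add_comm, ← eq_neg_iff_add_eq_zero] at this
      rw [this, neg_mul, mul_assoc, x_mul_pivotAnticomm hnm, mul_zero, neg_zero]
  · have h : pivot K n f = x K n * (x K (n + 1) * pivot K (n + 3) f) := by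
      rw [pivot_apply, partialDeriv_monomial_of_notMem hn hf, zero_add]
    rcases le_or_gt m (n + 3) with h3 | h3
    · left
      rw [h, pivot_monomial_of_lt (fun i hi => (hT i hi).trans_le h3) hf]
      simp
    rcases ih (k - 3) (by omega) h3 (by omega) with h0 | h0
    · left
      rw [h, h0]
      simp
    · right
      intro g
      rw [pivotAnticomm_of_add_two_le (by omega), ← mul_assoc, hc, mul_assoc, mul_assoc,
        ← mul_assoc f, hc, mul_assoc (_ ^ _), mul_assoc (x K (n + 1)), h0]
      simp

theorem sum_pivotWeight_union {S T : Finset ℕ} (h : Disjoint S T) :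
    ∑ i ∈ S ∪ T, pivotWeight i = ∑ i ∈ S, pivotWeight i + ∑ i ∈ T, pivotWeight i :=
  Finset.sum_union h

/-- The supercommutator of standard monomials is a multiple of a standard monomial. The two terms of
`superBracket_pivotMul` are not both nonzero. The term with `v_m` is again standard because neither
the letters of `S` nor the new letters of `v_n(x_T)` reach `m - 3`. -/
theorem IsStandardMultiple.superBracket_pivotMul {n m : ℕ} (hnm : n ≤ m) {S T : Finset ℕ}
    {f g : Grassmann K} (hf : f ∈ monomialLine K S) (hg : g ∈ monomialLine K T)
    (hS : IsStandard n S) (hT : IsStandard m T) {d e : Fin 3 → ℕ}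
    (hd : d + ∑ i ∈ S, pivotWeight i = pivotWeight n)
    (he : e + ∑ i ∈ T, pivotWeight i = pivotWeight m) :
    IsStandardMultiple (d + e) (superBracket (pivotMul f n) (pivotMul g m)) := by
  have hbr := PivotLie.superBracket_pivotMul hf hg n (m := m)
    (fun i hi => by have := hS.add_two_le i hi; omega)
  have hTm : ∀ i ∈ T, i < m := fun i hi => by have := hT.add_two_le i hi; omega
  have hex : pivot K n g = 0 ∨ n < m ∧ ∀ h, g * pivotAnticomm K n m h = 0 := by
    rcases hnm.eq_or_lt with rfl | hlt
    · exact Or.inl (pivot_monomial_of_lt hTm hg)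
    · exact (pivot_eq_zero_or_mul_pivotAnticomm_eq_zero hlt hg hTm).imp_right fun h => ⟨hlt, h⟩
  rcases hex with h0 | ⟨hlt, h0⟩
  · rcases mul_cases hf hg with hfg | ⟨hdis, hfg⟩
    · refine Or.inl (LinearMap.ext fun h => ?_)
      rw [hbr, h0, ← mul_assoc f g, hfg]
      simp
    have := (isStandardMultiple_mul_pivotAnticomm hnm hfg (d := d + e) (fun i hi => ?_) ?_).smul
      ((-1) ^ T.card)
    · convert this using 1
      refine LinearMap.ext fun h => ?_
      rw [hbr, h0]
      rcases T.card.even_or_odd with h' | h' <;>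
        simp [h'.neg_one_pow]
    · rcases Finset.mem_union.1 hi with hi | hi
      · have := hS.add_two_le i hi; omega
      · exact hT.add_two_le i hi
    · rw [sum_pivotWeight_union hdis, ← hd, ← he]
      abel
  · have hbr' : superBracket (pivotMul f n) (pivotMul g m) = pivotMul (f * pivot K n g) m :=
      LinearMap.ext fun h => by rw [hbr, h0]; simp
    rw [hbr']
    have hzero : f * pivot K n g = 0 → IsStandardMultiple (d + e) (pivotMul (f * pivot K n g) m) :=
      fun h => Or.inl (LinearMap.ext fun u => by simp [h])
    rcases pivot_monomial_cases n hg with h1 | ⟨U, hU, hw, hUT⟩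
    · exact hzero (by rw [h1, mul_zero])
    by_cases hnm2 : m = n + 1
    · refine hzero ?_
      rw [pivot_monomial_of_lt (fun i hi => ?_) hg, mul_zero]
      have := hT.add_two_le i hi
      omega
    rcases mul_cases hf hU with hfU | ⟨hdis, hfU⟩
    · exact hzero hfU
    -- letters of `S` and new letters of `U` are at most `m - 4`
    have hmem : ∀ i ∈ S ∪ U, i ∈ T ∨ i + 4 ≤ m := fun i hi => by
      rcases Finset.mem_union.1 hi with hi | hi
      · have := hS.add_two_le i hi; omega
      · rcases hUT i hi with hi | ⟨t, ht, hit⟩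
        · exact Or.inl hi
        · have := hT.add_two_le t ht; omega
    refine Or.inr ⟨_, _, _, ⟨fun i hi => ?_, fun i hi hSU => ?_⟩, ?_, hfU, rfl⟩
    · rcases hmem i hi with h | h
      · exact hT.add_two_le i h
      · omega
    · refine hT.not_both i hi ⟨(hmem _ hSU.1).resolve_right (by omega),
        (hmem _ hSU.2).resolve_right (by omega)⟩
    · rw [sum_pivotWeight_union hdis, ← he, hw, ← hd]
      abel

theorem IsStandardMultiple.exists_mem_endParity {d : Fin 3 → ℕ} {φ : Module.End K (Grassmann K)}
    (h : IsStandardMultiple d φ) : ∃ a, φ ∈ endParity K a := by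
  rcases h with rfl | ⟨n, S, f, hS, hd, hf, rfl⟩
  · exact ⟨0, Submodule.zero_mem _⟩
  · exact ⟨_, pivotMul_mem_endParity hf n⟩

theorem IsStandardMultiple.superBracket {d e : Fin 3 → ℕ} {φ ψ : Module.End K (Grassmann K)}
    (hφ : IsStandardMultiple d φ) (hψ : IsStandardMultiple e ψ) :
    IsStandardMultiple (d + e) (superBracket φ ψ) := by
  rcases hφ with rfl | ⟨n, S, f, hS, hd, hf, rfl⟩
  · exact Or.inl (LinearMap.map_zero₂ (superBracketHom K) ψ)
  rcases hψ with rfl | ⟨m, T, g, hT, he, hg, rfl⟩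
  · exact Or.inl (map_zero (superBracketHom K (pivotMul f n)))
  rcases le_total n m with h | h
  · exact superBracket_pivotMul h hf hg hS hT hd he
  · rw [superBracket_comm_of_mem (pivotMul_mem_endParity hg m) (pivotMul_mem_endParity hf n),
      add_comm]
    exact (superBracket_pivotMul h hg hf hT hS he hd).smul _

/-- The square of `x_S v_n` vanishes unless `S` is empty, since `x_S² = 0`. -/
theorem IsStandardMultiple.mul_self {d : Fin 3 → ℕ} {φ : Module.End K (Grassmann K)}
    (hφ : IsStandardMultiple d φ) : IsStandardMultiple (d + d) (φ * φ) := by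
  rcases hφ with rfl | ⟨n, S, f, hS, hd, hf, rfl⟩
  · exact Or.inl (zero_mul _)
  have hsq : ∀ g, (pivotMul f n * pivotMul f n) g =
      (-1) ^ S.card * (pivotMul (f * f * x K (n + 1)) (n + 3) g) := fun g => by
    rw [Module.End.mul_apply, pivotMul_apply, pivotMul_apply,
      pivot_monomial_mul_of_lt (fun i hi => by have := hS.add_two_le i hi; omega) hf,
      pivot_pivot_self, pivotMul_apply]
    rcases neg_one_pow_eq_or (Grassmann K) S.card with h | h <;> simp [h, mul_assoc]
  rcases mul_cases hf hf with h | ⟨hdis, hff⟩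
  · exact Or.inl (LinearMap.ext fun g => by rw [hsq, h]; simp)
  · obtain rfl : S = ∅ := disjoint_self.1 hdis
    convert isStandardMultiple_mul_sq hff (n := n) (d := d + d) (by simp) ?_ using 1
    · exact LinearMap.ext fun g => by rw [hsq]; simp
    · rw [← hd, two_smul]
      simp

theorem IsLieMonomial.isStandardMultiple {d : Fin 3 → ℕ} {φ : Module.End K (Grassmann K)}
    (h : IsLieMonomial K d φ) : IsStandardMultiple d φ := by
  induction h with
  | gen i =>
    refine Or.inr ⟨i, ∅, 1, ⟨by simp, by simp⟩, ?_, one_mem_monomialLine, (pivotMul_one _).symm⟩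
    fin_cases i <;> simp [pivotWeight]
  | bracket _ _ h1 h2 => exact h1.superBracket h2
  | sq _ _ _ h => exact h.mul_self

end

/-! ### Linear independence and the grading -/

section

variable {K : Type*} [Field K]

variable (K) in
/-- The standard monomial `x_S v_n`. -/
noncomputable def standardMonomial (p : ℕ × Finset ℕ) : Module.End K (Grassmann K) :=
  pivotMul (xMonomial K p.2) p.1

/-- The standard pairs `(n, S)` of multidegree `d`. -/
def standardPairs (d : Fin 3 → ℕ) : Set (ℕ × Finset ℕ) :=
  {p | IsStandard p.1 p.2 ∧ d + ∑ i ∈ p.2, pivotWeight i = pivotWeight p.1}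

theorem standardPairs_subsingleton (d : Fin 3 → ℕ) : (standardPairs d).Subsingleton := by
  rintro ⟨n, S⟩ ⟨hS, hd⟩ ⟨m, T⟩ ⟨hT, hd'⟩
  simp only at hS hd hT hd'
  obtain ⟨rfl, rfl⟩ := hS.eq_of_weight_eq hT (by rw [← hd, ← hd']; abel)
  rfl

theorem standardPairs_eq_of_mem {d e : Fin 3 → ℕ} {p : ℕ × Finset ℕ} (hd : p ∈ standardPairs d)
    (he : p ∈ standardPairs e) : d = e :=
  add_right_cancel (hd.2.trans he.2.symm)

/-- The monomials `x_S v_n` are linearly independent: `x_S v_n` maps `x_n` to `x_S`, and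
`x_T v_m` with `m > n` kills `x_n`. -/
theorem linearIndependent_standardMonomial : LinearIndependent K (standardMonomial K) := by
  classical
  rw [linearIndependent_iff']
  intro s c hc
  by_contra! hne
  obtain ⟨p, hp, hmin⟩ := Finset.exists_min_image (s.filter fun p => c p ≠ 0) Prod.fst
    (by obtain ⟨p, hp⟩ := hne; exact ⟨p, by simpa using hp⟩)
  rw [Finset.mem_filter] at hp
  have h := congrArg
    ((Finsupp.basisSingleOne : Module.Basis ℕ K (ℕ →₀ K)).ExteriorAlgebra.coord p.2)
    (LinearMap.congr_fun hc (x K p.1))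
  rw [LinearMap.sum_apply, map_sum, Finset.sum_eq_single p] at h
  · refine hp.2 ?_
    simpa [standardMonomial, pivot_x_self, xMonomial] using h
  · intro q hq hqp
    by_cases hcq : c q = 0
    · simp [hcq]
    rcases (hmin q (Finset.mem_filter.2 ⟨hq, hcq⟩)).lt_or_eq with h1 | h1
    · simp [standardMonomial, pivot_x_of_lt h1]
    · have h2 : q.2 ≠ p.2 := fun h2 => hqp (Prod.ext h1.symm h2)
      simp [standardMonomial, h1, pivot_x_self, xMonomial, h2]
  · exact fun h => absurd hp.1 h

theorem QComponent_le (d : Fin 3 → ℕ) :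
    QComponent K d ≤ Submodule.span K (standardMonomial K '' standardPairs d) := by
  refine Submodule.span_le.2 fun φ hφ => ?_
  rcases IsLieMonomial.isStandardMultiple hφ with rfl | ⟨n, S, f, hS, hd, hf, rfl⟩
  · exact Submodule.zero_mem _
  · obtain ⟨a, rfl⟩ := Submodule.mem_span_singleton.1 hf
    have h : pivotMul (a • xMonomial K S) n = a • standardMonomial K (n, S) :=
      LinearMap.ext fun g => by simp [standardMonomial]
    rw [h]
    exact Submodule.smul_mem _ _ (Submodule.subset_span ⟨(n, S), ⟨hS, hd⟩, rfl⟩)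

theorem exists_QComponent_le_span_singleton (d : Fin 3 → ℕ) :
    ∃ φ, QComponent K d ≤ K ∙ φ := by
  rcases (standardPairs_subsingleton d).eq_empty_or_singleton with h | ⟨p, h⟩
  · exact ⟨0, (QComponent_le d).trans (by simp [h])⟩
  · exact ⟨standardMonomial K p, (QComponent_le d).trans (by simp [h])⟩

theorem rank_QComponent_le_one (d : Fin 3 → ℕ) : Module.rank K (QComponent K d) ≤ 1 := by
  obtain ⟨φ, hφ⟩ := exists_QComponent_le_span_singleton (K := K) d
  exact (Submodule.rank_mono hφ).trans ((rank_span_le _).trans (by simp))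

theorem iSupIndep_QComponent : iSupIndep (QComponent K) := by
  intro d
  have h : Disjoint (standardPairs d) (⋃ e, ⋃ (_ : e ≠ d), standardPairs e) := by
    rw [Set.disjoint_left]
    intro p hp hp'
    simp only [Set.mem_iUnion] at hp'
    obtain ⟨e, hed, he⟩ := hp'
    exact hed (standardPairs_eq_of_mem he hp)
  refine ((linearIndependent_standardMonomial (K := K)).disjoint_span_image h).mono
    (QComponent_le d) (iSup₂_le fun e he => (QComponent_le e).trans ?_)
  exact Submodule.span_mono (Set.image_mono (Set.subset_iUnion₂_of_subset e he subset_rfl))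

theorem IsLieMonomial.exists_mem_endParity {d : Fin 3 → ℕ} {φ : Module.End K (Grassmann K)}
    (h : IsLieMonomial K d φ) : ∃ a, φ ∈ endParity K a :=
  h.isStandardMultiple.exists_mem_endParity

section Span

variable {X Y : Set (Module.End K (Grassmann K))} {T : Submodule K (Module.End K (Grassmann K))}

theorem parityPart_mem_span (hX : ∀ φ ∈ X, ∃ a, φ ∈ endParity K a) (a : ZMod 2)
    {φ : Module.End K (Grassmann K)} (hφ : φ ∈ Submodule.span K X) :
    parityPart a φ ∈ Submodule.span K (X ∩ endParity K a) := by
  suffices h : Submodule.span K X ≤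
      (Submodule.span K (X ∩ endParity K a)).comap (parityPartHom K a) from h hφ
  refine Submodule.span_le.2 fun ψ hψ => ?_
  obtain ⟨b, hb⟩ := hX ψ hψ
  change parityPart a ψ ∈ Submodule.span K (X ∩ endParity K a)
  rw [parityPart_of_mem hb]
  split_ifs with hab
  · exact Submodule.subset_span ⟨hψ, hab ▸ hb⟩
  · exact Submodule.zero_mem _

theorem superBracket_mem_of_mem_span (h : ∀ φ ∈ X, ∀ ψ ∈ Y, superBracket φ ψ ∈ T)
    {φ ψ : Module.End K (Grassmann K)} (hφ : φ ∈ Submodule.span K X)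
    (hψ : ψ ∈ Submodule.span K Y) : superBracket φ ψ ∈ T := by
  have : Submodule.map₂ (superBracketHom K) (Submodule.span K X) (Submodule.span K Y) ≤ T := by
    rw [Submodule.map₂_span_span, Submodule.span_le, Set.image2_subset_iff]
    exact h
  exact this (Submodule.apply_mem_map₂ _ hφ hψ)

/-- The formal square of an odd linear combination of homogeneous operators, by
`(φ + ψ)² = φ² + ψ² + [φ, ψ]` for odd `φ` and `ψ`. -/
theorem mul_self_mem_of_mem_span (hX : ∀ φ ∈ X, ∃ a, φ ∈ endParity K a)
    (hbr : ∀ φ ∈ X, ∀ ψ ∈ X, superBracket φ ψ ∈ T)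
    (hsq : ∀ φ ∈ X, φ ∈ endParity K 1 → φ * φ ∈ T)
    {φ : Module.End K (Grassmann K)} (hφ : φ ∈ Submodule.span K X) (hodd : φ ∈ endParity K 1) :
    φ * φ ∈ T := by
  have h := parityPart_mem_span hX 1 hφ
  rw [parityPart_of_mem hodd, if_pos rfl] at h
  have hle : Submodule.span K (X ∩ endParity K 1) ≤ endParity K 1 :=
    Submodule.span_le.2 Set.inter_subset_right
  have hle' : Submodule.span K (X ∩ endParity K 1) ≤ Submodule.span K X :=
    Submodule.span_mono Set.inter_subset_left
  clear hφ hodd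
  induction h using Submodule.span_induction with
  | mem ψ hψ => exact hsq ψ hψ.1 hψ.2
  | zero => rw [zero_mul]; exact Submodule.zero_mem _
  | add ψ χ hψ hχ hψ' hχ' =>
    have h := superBracket_mem_of_mem_span hbr (hle' hψ) (hle' hχ)
    rw [superBracket_of_mem (hle hψ) (hle hχ), show (1 : ZMod 2).val = 1 from rfl, mul_one, pow_one]
      at h
    have hneg : ψ * χ - (-1 : K) • (χ * ψ) = ψ * χ + χ * ψ := by module
    rw [hneg] at h
    convert Submodule.add_mem _ (Submodule.add_mem _ hψ' hχ') h using 1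
    noncomm_ring
  | smul c ψ _ hψ =>
    rw [smul_mul_smul_comm]
    exact Submodule.smul_mem _ _ hψ

end Span

theorem iSup_QComponent_eq_span :
    ⨆ d, QComponent K d = Submodule.span K {φ | ∃ d, IsLieMonomial K d φ} := by
  simp only [QComponent, ← Submodule.span_iUnion]
  congr 1
  ext φ
  simp

variable (K) in
theorem isLieSubsuperalgebra_iSup_QComponent :
    IsLieSubsuperalgebra (⨆ d, QComponent K d) := by
  rw [iSup_QComponent_eq_span]
  have hpar : ∀ φ ∈ {φ | ∃ d, IsLieMonomial K d φ}, ∃ a, φ ∈ endParity K a :=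
    fun φ ⟨_, hφ⟩ => hφ.exists_mem_endParity
  have hbr : ∀ φ ∈ {φ | ∃ d, IsLieMonomial K d φ}, ∀ ψ ∈ {φ | ∃ d, IsLieMonomial K d φ},
      superBracket φ ψ ∈ Submodule.span K {φ | ∃ d, IsLieMonomial K d φ} :=
    fun φ ⟨_, hφ⟩ ψ ⟨_, hψ⟩ => Submodule.subset_span ⟨_, hφ.bracket hψ⟩
  exact
    { parityPart_mem := fun a φ hφ =>
        Submodule.span_mono Set.inter_subset_left (parityPart_mem_span hpar a hφ)
      bracket_mem := fun φ hφ ψ hψ => superBracket_mem_of_mem_span hbr hφ hψ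
      sq_mem := fun h2 φ hφ hodd => mul_self_mem_of_mem_span hpar hbr
        (fun ψ ⟨_, hψ⟩ hψ1 => Submodule.subset_span ⟨_, hψ.sq h2 hψ1⟩) hφ hodd }

theorem IsLieMonomial.mem {S : Submodule K (Module.End K (Grassmann K))}
    (hS : IsLieSubsuperalgebra S) (hv : ∀ i : Fin 3, pivot K i ∈ S) {d : Fin 3 → ℕ}
    {φ : Module.End K (Grassmann K)} (h : IsLieMonomial K d φ) : φ ∈ S := by
  induction h with
  | gen i => exact hv i
  | bracket _ _ h1 h2 => exact hS.bracket_mem _ h1 _ h2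
  | sq h2 _ hodd h => exact hS.sq_mem h2 _ h hodd

variable (K) in
theorem iSup_QComponent : ⨆ d, QComponent K d = Q K := by
  refine le_antisymm (le_sInf fun S hS => iSup_le fun d => Submodule.span_le.2 fun φ hφ =>
    IsLieMonomial.mem hS.1 hS.2 hφ) (sInf_le ⟨isLieSubsuperalgebra_iSup_QComponent K, fun i => ?_⟩)
  exact Submodule.mem_iSup_of_mem _ (Submodule.subset_span (IsLieMonomial.gen i))

variable (K) in
theorem isGrading_QComponent : IsGrading (Q K) (QComponent K) where
  iSup_eq := iSup_QComponent K
  indep := iSupIndep_QComponent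
  parityPart_mem _ a _ hφ := Submodule.span_mono Set.inter_subset_left
    (parityPart_mem_span (fun _ hψ => IsLieMonomial.exists_mem_endParity hψ) a hφ)
  bracket_mem _ _ _ hφ _ hψ := superBracket_mem_of_mem_span
    (fun _ h _ h' => Submodule.subset_span (IsLieMonomial.bracket h h')) hφ hψ
  sq_mem h2 _ _ hφ hodd := mul_self_mem_of_mem_span
    (fun _ hψ => IsLieMonomial.exists_mem_endParity hψ)
    (fun _ h _ h' => Submodule.subset_span (IsLieMonomial.bracket h h'))
    (fun _ h h' => Submodule.subset_span (IsLieMonomial.sq h2 h h')) hφ hodd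

/-- A grading with components of dimension at most one has no proper refinement. -/
theorem IsGrading.isFineGrading {ι : Type*} [AddMonoid ι]
    {L : Submodule K (Module.End K (Grassmann K))}
    {𝒜 : ι → Submodule K (Module.End K (Grassmann K))} (h : IsGrading L 𝒜)
    (hdim : ∀ i, ∃ φ, 𝒜 i ≤ K ∙ φ) : IsFineGrading L 𝒜 := by
  refine ⟨h, fun 𝒟 h𝒟 hle => ?_⟩
  have heq : ∀ D ∈ 𝒟, ∀ i, D ≤ 𝒜 i → D = 𝒜 i := fun D hD i hi => by
    obtain ⟨φ, hφ⟩ := hdim i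
    refine le_antisymm hi (hφ.trans ?_)
    obtain ⟨ψ, hψ, hψ0⟩ := Submodule.exists_mem_ne_zero_of_ne_bot (h𝒟.ne_bot D hD)
    obtain ⟨c, rfl⟩ := Submodule.mem_span_singleton.1 (hφ (hi hψ))
    rw [Submodule.span_singleton_le_iff_mem]
    exact (Submodule.smul_mem_iff D fun hc => hψ0 (by rw [hc, zero_smul])).1 hψ
  ext D
  constructor
  · intro hD
    obtain ⟨i, hi⟩ := hle D hD
    exact ⟨h𝒟.ne_bot D hD, i, heq D hD i hi⟩
  · rintro ⟨hD, i, rfl⟩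
    -- if the component is not in `𝒟`, then `𝒟` only spans the sum of the other components
    by_contra hmem
    refine hD (disjoint_self.1 ((h.indep i).mono_right ?_))
    calc 𝒜 i ≤ L := h.iSup_eq ▸ le_iSup 𝒜 i
      _ = sSup 𝒟 := h𝒟.sSup_eq.symm
      _ ≤ ⨆ (j) (_ : j ≠ i), 𝒜 j := sSup_le fun E hE => by
        obtain ⟨j, hj⟩ := hle E hE
        refine hj.trans (le_iSup₂_of_le j ?_ le_rfl)
        rintro rfl
        exact hmem (heq E hE j hj ▸ hE)

end

end PivotLie

theorem mainTheorem2 (K : Type*) [Field K] :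
    PivotLie.IsGrading (PivotLie.Q K) (PivotLie.QComponent K) ∧
      (∀ n : Fin 3 → ℕ, Module.rank K (PivotLie.QComponent K n) ≤ 1) ∧
      PivotLie.IsFineGrading (PivotLie.Q K) (PivotLie.QComponent K) :=
  ⟨PivotLie.isGrading_QComponent K, PivotLie.rank_QComponent_le_one,
    (PivotLie.isGrading_QComponent K).isFineGrading
      PivotLie.exists_QComponent_le_span_singleton⟩
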